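/- Let $n\ge 1$. Consider finite sets $A=\{a_0,\dots,a_{n+1}\}\subset\mathbb{Z}^n$ of $n+2$ distinct points whose convex hull has full dimension $n$ (that is, $A$ has dimension $n$ and codimension $m=\#A-(n+1)=1$), and systems of $n$ Laurent polynomials $$f_i(x)=\sum_{j=0}^{n+1}c_{ij}\,x^{a_j}=0,\qquad i=1,\dots,n,$$ supported on $A$ whose coefficient matrix $C=(c_{ij})\in\mathbb{C}^{n\times(n+2)}$ has rank $n$. For an isolated solution $q$ of such a system in the torus $(\mathbb{C}^*)^n$, its (local intersection) multiplicity is the dimension over $\mathbb{C}$ of the localization at $q$ of $\mathbb{C}[x_1^{\pm1},\dots,x_n^{\pm1}]/(f_1,\dots,f_n)$. Then the maximum of the multiplicity at $\mathbf 1=(1,\dots,1)$, over all such $A$ and $C$ for which $\mathbf 1$ is an isolated solution of the system, equals $n+1$. Moreover, the maximum is attained by the cyclic system $$f_d(x)=\sum_{k=0}^{d}(-1)^k\binom{d}{k}\,x_1^{k}x_2^{k^2}\cdots x_n^{k^n}=0,\qquad d=2,\dots,n+1,$$ with support in $A=\{(k,k^2,\dots,k^n):0\le k\le n+1\}$: these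 $A$ and its coefficient matrix satisfy the above conditions, $\mathbf 1$ is an isolated solution, and its multiplicity is exactly $n+1$. -/

import Mathlib

open Topology

noncomputable section

namespace SparseSystem

/-- The ring of Laurent polynomials in `n` variables with complex coefficients: the group
algebra of the lattice of exponents. -/
abbrev Laurent (n : ℕ) : Type := AddMonoidAlgebra ℂ (Fin n → ℤ)

/-- A finite family of distinct exponents whose convex hull has full dimension `n`.
For `N = n + m + 1` points, `m` is the codimension. -/
structure IsConfiguration {n N : ℕ} (a : Fin N → Fin n → ℤ) : Prop where
  injective : Function.Injective a
  full : affineSpan ℝ (convexHull ℝ (Set.range fun j => fun i => (a j i : ℝ))) = ⊤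

/-- The monomial character `α ↦ q ^ α = ∏ i, q i ^ α i` of a point of the torus. -/
def monomialChar {n : ℕ} (q : Fin n → ℂˣ) : Multiplicative (Fin n → ℤ) →* ℂ where
  toFun α := ((∏ i, q i ^ (Multiplicative.toAdd α i) : ℂˣ) : ℂ)
  map_one' := by simp
  map_mul' α β := by
    simp [zpow_add₀, Finset.prod_mul_distrib]

/-- Evaluation of Laurent polynomials at a point of the torus. -/
def evalAt {n : ℕ} (q : Fin n → ℂˣ) : Laurent n →ₐ[ℂ] ℂ :=
  AddMonoidAlgebra.lift ℂ ℂ (Fin n → ℤ) (monomialChar q)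

/-- The `i`-th Laurent polynomial `∑ j, C i j * x ^ (a j)` of the system `C · x ^ A`. -/
def poly {n N : ℕ} (a : Fin N → Fin n → ℤ) (C : Matrix (Fin n) (Fin N) ℂ) (i : Fin n) :
    Laurent n :=
  ∑ j, AddMonoidAlgebra.single (a j) (C i j)

theorem evalAt_poly {n N : ℕ} (a : Fin N → Fin n → ℤ) (C : Matrix (Fin n) (Fin N) ℂ)
    (i : Fin n) (q : Fin n → ℂˣ) :
    evalAt q (poly a C i) = ∑ j, C i j * ∏ k, (q k : ℂ) ^ a j k := by
  simp [evalAt, poly, monomialChar, map_sum]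

/-- The solutions in the torus of the system `C · x ^ A = 0`. -/
def solutions {n N : ℕ} (a : Fin N → Fin n → ℤ) (C : Matrix (Fin n) (Fin N) ℂ) :
    Set (Fin n → ℂˣ) :=
  {x | ∀ i, evalAt x (poly a C i) = 0}

/-- `q` is an isolated solution of the system in the torus. -/
def IsIsolatedSolution {n N : ℕ} (a : Fin N → Fin n → ℤ) (C : Matrix (Fin n) (Fin N) ℂ)
    (q : Fin n → ℂˣ) : Prop :=
  ∃ U ∈ 𝓝 q, U ∩ solutions a C = {q}

/-- The maximal ideal of a point of the torus. -/
def pointIdeal {n : ℕ} (q : Fin n → ℂˣ) : Ideal (Laurent n) :=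
  RingHom.ker (evalAt q)

instance {n : ℕ} (q : Fin n → ℂˣ) : (pointIdeal q).IsPrime :=
  RingHom.ker_isPrime _

/-- The ideal generated by the polynomials of the system. -/
def systemIdeal {n N : ℕ} (a : Fin N → Fin n → ℤ) (C : Matrix (Fin n) (Fin N) ℂ) :
    Ideal (Laurent n) :=
  Ideal.span (Set.range (poly a C))

/-- The local ring at `q` of the scheme defined by the system: the localization at `q` of the
quotient of the ring of Laurent polynomials by the ideal of the system. -/
abbrev LocalAlgebra {n N : ℕ} (a : Fin N → Fin n → ℤ) (C : Matrix (Fin n) (Fin N) ℂ)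
    (q : Fin n → ℂˣ) : Type :=
  Localization.AtPrime (pointIdeal q) ⧸
    (systemIdeal a C).map (algebraMap (Laurent n) (Localization.AtPrime (pointIdeal q)))

/-- The local intersection multiplicity at `q`: the complex dimension of the local algebra,
which is `⊤` if that dimension is infinite. -/
def multiplicity {n N : ℕ} (a : Fin N → Fin n → ℤ) (C : Matrix (Fin n) (Fin N) ℂ)
    (q : Fin n → ℂˣ) : ℕ∞ :=
  Cardinal.toENat (Module.rank ℂ (LocalAlgebra a C q))

/-- The exponents `(j, j ^ 2, …, j ^ n)`, `j = 0, …, n + m`, of the cyclic system. -/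
def cyclicExponents (n m : ℕ) : Fin (n + m + 1) → Fin n → ℤ :=
  fun j i => (j : ℤ) ^ ((i : ℕ) + 1)

/-- The coefficients of the cyclic system: its polynomials are
`∑ j, (-1) ^ j * (d choose j) * x_1 ^ j * x_2 ^ (j ^ 2) ⋯ x_n ^ (j ^ n)` for
`d = m + 1, …, m + n`. -/
def cyclicCoeffs (n m : ℕ) : Matrix (Fin n) (Fin (n + m + 1)) ℂ :=
  fun i j => (-1) ^ (j : ℕ) * ((m + ((i : ℕ) + 1)).choose (j : ℕ) : ℂ)

end SparseSystem

end

/-! Gale duality reduces the system to one variable. Since `C` has rank `n` and kills the vector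
`1`, its kernel is spanned by `1` and a vector `w` with `w 0 = 0`, `w l = 1`. Hence a solution `x`,
in any commutative algebra, satisfies `x ^ (a j - a 0) = 1 + w j * y` with `y = x ^ (a l - a 0) -
1`, and every affine relation `r` among the exponents gives `∏ (1 + w j * y) ^ r j = 1`, that is,
`relPoly w r` vanishes at `y`.

Upper bound: locally at `1` the parameter `y` generates the maximal ideal modulo the system, so the
multiplicity is at most the order of `relPoly` at `0` (`rank_localAlgebra_le`). Order at least `n +
2` would make the moments `∑ r j * w j ^ k` vanish for all `k ≤ n + 1`. As there are only `n + 2`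
points, `∑ r j * g (w j) = 0` for every function `g`; taking `g` to be `z ↦ log (1 + z * y)`
produces a curve of solutions through `1` (`not_isIsolatedSolution`).

Lower bound: for the cyclic system `w j = j`, and truncating `log (1 + j X)` gives a formal curve
that solves the system modulo `X ^ (n + 1)`. It maps the local algebra to `ℂ⟦X⟧ / (X ^ (n + 1))`
with `X` in the image (`cyclic_le_rank`). -/

noncomputable section

namespace SparseSystem

/-! ### Logarithmic derivatives of power series -/

open PowerSeries in
/-- The logarithmic derivative of a product of powers. -/
theorem derivative_prod_pow {ι : Type*} (s : Finset ι) (Q S : ι → PowerSeries ℂ)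
    (hQ : ∀ j, d⁄dX ℂ (Q j) = Q j * S j) (c : ι → ℕ) :
    d⁄dX ℂ (∏ j ∈ s, Q j ^ c j) = (∏ j ∈ s, Q j ^ c j) * ∑ j ∈ s, (c j : PowerSeries ℂ) * S j := by
  classical
  have hpow : ∀ j, ∀ m : ℕ, d⁄dX ℂ (Q j ^ m) = Q j ^ m * (m * S j) := by
    intro j m
    induction m with
    | zero => simp
    | succ m ih => rw [pow_succ, Derivation.leibniz, ih, hQ]; simp only [smul_eq_mul]; push_cast; ring
  induction s using Finset.induction_on with
  | empty => simp
  | insert a s ha ih =>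
    rw [Finset.prod_insert ha, Finset.sum_insert ha, Derivation.leibniz, ih, hpow]
    simp only [smul_eq_mul]; ring

open PowerSeries in
theorem X_pow_dvd_derivative {f : PowerSeries ℂ} {m : ℕ} (h : X ^ (m + 1) ∣ f) :
    X ^ m ∣ d⁄dX ℂ f := by
  rw [X_pow_dvd_iff] at h ⊢
  intro k hk
  rw [coeff_derivative, h _ (by omega), zero_mul]

open PowerSeries in
theorem X_pow_succ_dvd_of_derivative {f : PowerSeries ℂ} {m : ℕ} (h0 : constantCoeff f = 0)
    (h : X ^ m ∣ d⁄dX ℂ f) : X ^ (m + 1) ∣ f := by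
  rw [X_pow_dvd_iff] at h ⊢
  intro k hk
  cases k with
  | zero => simpa using h0
  | succ k =>
    have := h k (by omega)
    rw [coeff_derivative] at this
    exact (mul_eq_zero.1 this).resolve_right (by exact_mod_cast Nat.succ_ne_zero k)

open PowerSeries in
-- The difference `D = F - G` solves `D' = D * S + G * (S - S')`, so each integration gains one
-- order of vanishing until the forcing term `G * (S - S')` limits it.
theorem X_pow_succ_dvd_sub_of_logDeriv {F G S S' : PowerSeries ℂ} {m : ℕ}
    (hF : d⁄dX ℂ F = F * S) (hG : d⁄dX ℂ G = G * S')
    (h0 : constantCoeff F = constantCoeff G) (h : X ^ m ∣ S - S') : X ^ (m + 1) ∣ F - G := by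
  have hd : d⁄dX ℂ (F - G) = (F - G) * S + G * (S - S') := by rw [map_sub, hF, hG]; ring
  suffices H : ∀ k ≤ m + 1, X ^ k ∣ F - G from H _ le_rfl
  intro k
  induction k with
  | zero => simp
  | succ k ih =>
    intro hk
    apply X_pow_succ_dvd_of_derivative (by simp [h0])
    rw [hd]
    exact dvd_add ((ih (by omega)).mul_right _)
      (((pow_dvd_pow _ (by omega)).trans h).mul_left _)

open PowerSeries in
theorem X_pow_dvd_logDeriv_sub {F G S S' : PowerSeries ℂ} {m : ℕ}
    (hF : d⁄dX ℂ F = F * S) (hG : d⁄dX ℂ G = G * S')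
    (hG1 : IsUnit G) (h : X ^ (m + 1) ∣ F - G) : X ^ m ∣ S - S' := by
  have hd : d⁄dX ℂ (F - G) = (F - G) * S + G * (S - S') := by rw [map_sub, hF, hG]; ring
  have h1 := X_pow_dvd_derivative h
  rw [hd] at h1
  have h2 : X ^ m ∣ G * (S - S') :=
    (dvd_add_right (((pow_dvd_pow _ (Nat.le_succ m)).trans h).mul_right S)).1 h1
  exact hG1.dvd_mul_left.1 h2

/-- The logarithmic derivative of `1 + w X`. -/
def logDerivLinear (w : ℂ) : PowerSeries ℂ := PowerSeries.mk fun k => w * (-w) ^ k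

open PowerSeries in
theorem derivative_linear (w : ℂ) :
    d⁄dX ℂ (1 + C w * X : PowerSeries ℂ) = (1 + C w * X) * logDerivLinear w := by
  have : d⁄dX ℂ (1 + C w * X : PowerSeries ℂ) = C w := by
    rw [map_add, Derivation.leibniz, derivative_C, derivative_X, derivative_one]; simp
  rw [this]
  ext k
  rw [add_mul, one_mul, mul_assoc, map_add, coeff_C_mul, logDerivLinear, coeff_mk]
  cases k with
  | zero => simp
  | succ k => rw [coeff_succ_X_mul, coeff_mk, coeff_C, if_neg (by omega), pow_succ]; ring

/-! ### The univariate polynomial of an affine relation and its moments -/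

/-- One side of the binomial relation attached to an affine relation `c` between the exponents. -/
def relProd {N : ℕ} (w : Fin N → ℂ) (c : Fin N → ℕ) : Polynomial ℂ :=
  ∏ j, (1 + Polynomial.C (w j) * Polynomial.X) ^ c j

/-- The univariate polynomial attached to an affine relation `l` between the exponents. -/
def relPoly {N : ℕ} (w : Fin N → ℂ) (l : Fin N → ℤ) : Polynomial ℂ :=
  relProd w (fun j => (l j).toNat) - relProd w (fun j => (-l j).toNat)

theorem relProd_coe {N : ℕ} (w : Fin N → ℂ) (c : Fin N → ℕ) :
    (relProd w c : PowerSeries ℂ) =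
      ∏ j, (1 + PowerSeries.C (w j) * PowerSeries.X : PowerSeries ℂ) ^ c j := by
  rw [relProd, ← Polynomial.coeToPowerSeries.ringHom_apply, map_prod]
  simp

theorem toNat_sub_toNat_cast (z : ℤ) : ((z.toNat : ℂ) - ((-z).toNat : ℂ)) = z := by
  exact_mod_cast congrArg (Int.cast (R := ℂ)) (Int.toNat_sub_toNat_neg z)

/-- The logarithmic derivatives of the two sides of the relation differ by a series whose `k`-th
coefficient is `(-1) ^ k * ∑ l j * w j ^ (k + 1)`. -/
theorem sum_mul_pow_eq_zero_of_dvd {N m : ℕ} (w : Fin N → ℂ) (l : Fin N → ℤ)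
    (h : Polynomial.X ^ (m + 1) ∣ relPoly w l) {k : ℕ} (hk : k < m) :
    ∑ j, (l j : ℂ) * w j ^ (k + 1) = 0 := by
  have h1 : (PowerSeries.X : PowerSeries ℂ) ^ (m + 1) ∣
      (relProd w (fun j => (l j).toNat) : PowerSeries ℂ) -
        (relProd w (fun j => (-l j).toNat) : PowerSeries ℂ) := by
    obtain ⟨q, hq⟩ := h
    refine ⟨(q : PowerSeries ℂ), ?_⟩
    rw [relPoly] at hq
    have := congrArg (Polynomial.coeToPowerSeries.ringHom (R := ℂ)) hq
    simpa using this
  rw [relProd_coe, relProd_coe] at h1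
  have hu : IsUnit (∏ j, (1 + PowerSeries.C (w j) * PowerSeries.X : PowerSeries ℂ) ^
      (-l j).toNat) := by
    rw [PowerSeries.isUnit_iff_constantCoeff]
    simp
  have h2 := X_pow_dvd_logDeriv_sub (derivative_prod_pow _ _ _ (fun j => derivative_linear (w j)) _)
    (derivative_prod_pow _ _ _ (fun j => derivative_linear (w j)) _) hu h1
  rw [PowerSeries.X_pow_dvd_iff] at h2
  have h3 := h2 k hk
  rw [← Finset.sum_sub_distrib, map_sum] at h3
  have h4 : ∀ j, PowerSeries.coeff k (((l j).toNat : PowerSeries ℂ) * logDerivLinear (w j) -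
      ((-l j).toNat : PowerSeries ℂ) * logDerivLinear (w j)) =
      (-1) ^ k * ((l j : ℂ) * w j ^ (k + 1)) := by
    intro j
    rw [← sub_mul, ← map_natCast (PowerSeries.C (R := ℂ)), ← map_natCast (PowerSeries.C (R := ℂ)),
      ← map_sub, toNat_sub_toNat_cast, PowerSeries.coeff_C_mul, logDerivLinear,
      PowerSeries.coeff_mk, neg_pow]
    ring
  rw [Finset.sum_congr rfl fun j _ => h4 j, ← Finset.mul_sum] at h3
  exact (mul_eq_zero.1 h3).resolve_left (pow_ne_zero _ (by norm_num))

/-- A combination of evaluations at `N` points that kills small powers kills every function. -/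
theorem sum_mul_apply_eq_zero {N : ℕ} (w l : Fin N → ℂ)
    (h : ∀ k < N, ∑ j, l j * w j ^ k = 0) (g : ℂ → ℂ) : ∑ j, l j * g (w j) = 0 := by
  classical
  -- Interpolation on the set of values of `w`, so that repeated values are harmless and the degree
  -- stays below `N`.
  set p := Lagrange.interpolate (Finset.univ.image w) id g with hp
  have hdeg : p.degree < N := by
    refine (Lagrange.degree_interpolate_lt g (Set.injOn_id _)).trans_le ?_
    exact_mod_cast Finset.card_image_le.trans (by simp)
  have hev : ∀ j, g (w j) = p.eval (w j) := fun j =>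
    (Lagrange.eval_interpolate_at_node g (v := id) (Set.injOn_id _)
      (Finset.mem_image_of_mem w (Finset.mem_univ j))).symm
  have hsum : ∀ j, l j * g (w j) = ∑ k : Fin N, p.coeff k * (l j * w j ^ (k : ℕ)) := by
    intro j
    rcases Nat.eq_zero_or_pos N with h0 | hN
    · subst h0; exact j.elim0
    have hnat : p.natDegree < N := by
      by_cases h0 : p = 0
      · simpa [h0] using hN
      · exact (Polynomial.natDegree_lt_iff_degree_lt h0).2 hdeg
    rw [hev, Polynomial.eval_eq_sum_range' hnat, Finset.mul_sum, Finset.sum_range]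
    exact Finset.sum_congr rfl fun k _ => by ring
  rw [Finset.sum_congr rfl fun j _ => hsum j, Finset.sum_comm]
  refine Finset.sum_eq_zero fun k _ => ?_
  rw [← Finset.mul_sum, h k k.2, mul_zero]

/-! ### Exponent matrix and the affine relation given by its minors -/

/-- The matrix whose rows are the exponents with a leading `1`. -/
def augMatrix {n N : ℕ} (a : Fin N → Fin n → ℤ) : Matrix (Fin N) (Fin (n + 1)) ℤ :=
  fun j => Fin.cons 1 (a j)

/-- A kernel vector is an affine function that vanishes at the points, hence on their affine span,
which is the whole space. -/
theorem IsConfiguration.eq_zero {n N : ℕ} {a : Fin N → Fin n → ℤ} (ha : IsConfiguration a)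
    {v : Fin (n + 1) → ℤ} (hv : (augMatrix a).mulVec v = 0) : v = 0 := by
  let f : (Fin n → ℝ) →ᵃ[ℝ] ℝ := AffineMap.const ℝ _ (v 0 : ℝ) +
    (∑ i, (v i.succ : ℝ) • (LinearMap.proj i : (Fin n → ℝ) →ₗ[ℝ] ℝ)).toAffineMap
  have hf : ∀ x, f x = v 0 + ∑ i, v i.succ * x i := by intro x; simp [f]
  have hspan := ha.full
  rw [affineSpan_convexHull] at hspan
  have h0 : ∀ x, f x = 0 := by
    intro x
    have hx : f x ∈ (affineSpan ℝ (Set.range fun j => fun i => (a j i : ℝ))).map f :=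
      ⟨x, by rw [hspan]; exact AffineSubspace.mem_top ℝ _ x, rfl⟩
    rw [AffineSubspace.map_span] at hx
    have hsub : f '' (Set.range fun j => fun i => (a j i : ℝ)) ⊆ {0} := by
      rintro _ ⟨_, ⟨j, rfl⟩, rfl⟩
      have := congrFun hv j
      simp only [Matrix.mulVec, dotProduct, augMatrix, Fin.sum_univ_succ, Fin.cons_zero,
        Fin.cons_succ, one_mul, Pi.zero_apply] at this
      rw [Set.mem_singleton_iff, hf]
      have h2 : ((v 0 + ∑ i, a j i * v i.succ : ℤ) : ℝ) = 0 := by rw [this]; simp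
      push_cast at h2
      simpa [mul_comm] using h2
    have := affineSpan_mono ℝ hsub hx
    simpa using this
  have hv0 : v 0 = 0 := by have := h0 0; rw [hf] at this; simpa using this
  funext i
  refine Fin.cases hv0 (fun i => ?_) i
  have := h0 (Pi.single i 1)
  rw [hf, hv0] at this
  simpa [Pi.single_apply] using this

/-- The Gram matrix `MᵀM` is nonsingular, since `MᵀMv = 0` forces `Mv · Mv = 0`. Its adjugate
inverts `M` up to the factor `d` while staying over the integers. -/
theorem IsConfiguration.exists_leftInverse {n N : ℕ} {a : Fin N → Fin n → ℤ}
    (ha : IsConfiguration a) :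
    ∃ d : ℤ, d ≠ 0 ∧ ∃ B : Matrix (Fin (n + 1)) (Fin N) ℤ, B * augMatrix a = d • 1 := by
  refine ⟨((augMatrix a).transpose * augMatrix a).det, ?_,
    ((augMatrix a).transpose * augMatrix a).adjugate * (augMatrix a).transpose, ?_⟩
  · intro h
    obtain ⟨v, hv, hv0⟩ := Matrix.exists_mulVec_eq_zero_iff.2 h
    apply hv
    apply ha.eq_zero
    rw [← dotProduct_self_eq_zero, Matrix.dotProduct_mulVec, Matrix.vecMul_mulVec,
      ← Matrix.dotProduct_mulVec, hv0, dotProduct_zero]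
  · rw [Matrix.mul_assoc, Matrix.adjugate_mul]

/-- The signed maximal minors of the augmented matrix: an affine relation between the points. -/
def minorRel {n : ℕ} (a : Fin (n + 1 + 1) → Fin n → ℤ) (j : Fin (n + 1 + 1)) : ℤ :=
  (-1) ^ (j : ℕ) * ((augMatrix a).submatrix j.succAbove id).det

/-- Laplace expansion along the first column. It turns orthogonality to `minorRel a` into
singularity of a square matrix. -/
theorem sum_minorRel_mul {n : ℕ} (a : Fin (n + 1 + 1) → Fin n → ℤ) {R : Type*} [CommRing R]
    (L : Fin (n + 1 + 1) → R) :
    ∑ j, (minorRel a j : R) * L j =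
      (Matrix.of fun j => Fin.cons (L j) (fun k => ((augMatrix a j k : ℤ) : R))).det := by
  rw [Matrix.det_succ_column_zero]
  refine Finset.sum_congr rfl fun j _ => ?_
  have : ((augMatrix a).submatrix j.succAbove id).map (fun x => (x : R)) =
      (Matrix.of fun j => (Fin.cons (L j) (fun k => ((augMatrix a j k : ℤ) : R)) :
        Fin (n + 1 + 1) → R)).submatrix j.succAbove Fin.succ := by
    ext x y; simp
  rw [minorRel]
  push_cast
  rw [this]
  simp only [Matrix.of_apply, Fin.cons_zero]
  ring

theorem sum_minorRel_mul_augMatrix {n : ℕ} (a : Fin (n + 1 + 1) → Fin n → ℤ) (k : Fin (n + 1)) :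
    ∑ j, minorRel a j * augMatrix a j k = 0 := by
  have := sum_minorRel_mul a (R := ℤ) (fun j => augMatrix a j k)
  simp only [Int.cast_id] at this
  rw [this]
  apply Matrix.det_zero_of_column_eq (i := 0) (j := k.succ) (Fin.succ_ne_zero k).symm
  intro j; simp

theorem sum_minorRel {n : ℕ} (a : Fin (n + 1 + 1) → Fin n → ℤ) : ∑ j, minorRel a j = 0 := by
  simpa [augMatrix] using sum_minorRel_mul_augMatrix a 0

theorem sum_minorRel_smul {n : ℕ} (a : Fin (n + 1 + 1) → Fin n → ℤ) :
    ∑ j, minorRel a j • a j = 0 := by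
  funext k
  simpa [augMatrix] using sum_minorRel_mul_augMatrix a k.succ

/-- The singular matrix has a kernel vector `u`. If `u 0` were zero, the columns of `augMatrix a`
would be dependent, against the left inverse; dividing by `-u 0` gives the affine function. -/
theorem exists_affine_of_sum_minorRel {n : ℕ} {a : Fin (n + 1 + 1) → Fin n → ℤ}
    (ha : IsConfiguration a) (L : Fin (n + 1 + 1) → ℂ) (hL : ∑ j, (minorRel a j : ℂ) * L j = 0) :
    ∃ v : Fin (n + 1) → ℂ, ∀ j, L j = ∑ k, (augMatrix a j k : ℂ) * v k := by
  rw [sum_minorRel_mul] at hL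
  obtain ⟨u, hu, hu0⟩ := Matrix.exists_mulVec_eq_zero_iff.2 hL
  have hj : ∀ j, L j * u 0 + ∑ k, (augMatrix a j k : ℂ) * u k.succ = 0 := by
    intro j
    have := congrFun hu0 j
    simpa [Matrix.mulVec, dotProduct, Fin.sum_univ_succ (n := n + 1)] using this
  by_cases h0 : u 0 = 0
  · exfalso
    obtain ⟨d, hd, B, hB⟩ := ha.exists_leftInverse
    apply hu
    funext i
    refine Fin.cases h0 (fun i => ?_) i
    have h1 : ∑ j, (B i j : ℂ) * ∑ k, (augMatrix a j k : ℂ) * u k.succ = 0 := by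
      refine Finset.sum_eq_zero fun j _ => ?_
      have := hj j
      rw [h0, mul_zero, zero_add] at this
      rw [this, mul_zero]
    have h2 : ∑ j, (B i j : ℂ) * ∑ k, (augMatrix a j k : ℂ) * u k.succ =
        ∑ k, (((B * augMatrix a) i k : ℤ) : ℂ) * u k.succ := by
      simp only [Finset.mul_sum, Matrix.mul_apply, Int.cast_sum, Finset.sum_mul, Int.cast_mul]
      rw [Finset.sum_comm]
      simp only [mul_assoc]
    rw [h2, hB] at h1
    simp [Matrix.one_apply, hd] at h1
    exact h1
  · refine ⟨fun k => -(u k.succ / u 0), fun j => ?_⟩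
    have h1 : L j * u 0 = -∑ k, (augMatrix a j k : ℂ) * u k.succ := eq_neg_of_add_eq_zero_left (hj j)
    rw [eq_div_of_mul_eq h0 h1, neg_div, Finset.sum_div, ← Finset.sum_neg_distrib]
    exact Finset.sum_congr rfl fun k _ => by ring

/-! ### Gale duality -/

/-- A Gale dual vector for a system of rank `n` that `1` solves: up to the constant vector, `w`
spans the kernel of `C`. -/
structure IsGaleDual {n : ℕ} (C : Matrix (Fin n) (Fin (n + 1 + 1)) ℂ)
    (w : Fin (n + 1 + 1) → ℂ) (l : Fin (n + 1 + 1)) : Prop where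
  sum_eq : ∀ i, ∑ j, C i j = 0
  sum_mul : ∀ i, ∑ j, C i j * w j = 0
  zero : w 0 = 0
  one : w l = 1
  rank : C.rank = n

theorem finrank_ker_mulVecLin {n : ℕ} {C : Matrix (Fin n) (Fin (n + 1 + 1)) ℂ} (hr : C.rank = n) :
    Module.finrank ℂ (LinearMap.ker C.mulVecLin) = 2 := by
  have := LinearMap.finrank_range_add_finrank_ker C.mulVecLin
  rw [← Matrix.rank, hr] at this
  simp at this
  omega

theorem exists_isGaleDual {n : ℕ} {C : Matrix (Fin n) (Fin (n + 1 + 1)) ℂ} (hr : C.rank = n)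
    (h1 : ∀ i, ∑ j, C i j = 0) : ∃ w l, IsGaleDual C w l := by
  have hk : ¬ LinearMap.ker C.mulVecLin ≤ Submodule.span ℂ {1} := by
    intro hle
    have := Submodule.finrank_mono hle
    rw [finrank_ker_mulVecLin hr, finrank_span_singleton one_ne_zero] at this
    omega
  obtain ⟨v, hv, hv1⟩ := SetLike.not_le_iff_exists.1 hk
  have hne : ∃ l, v l - v 0 ≠ 0 := by
    by_contra! h
    apply hv1
    rw [Submodule.mem_span_singleton]
    exact ⟨v 0, funext fun j => by simpa using (sub_eq_zero.1 (h j)).symm⟩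
  obtain ⟨l, hl⟩ := hne
  refine ⟨fun j => (v j - v 0) / (v l - v 0), l, h1, fun i => ?_, by simp, div_self hl, hr⟩
  have hvi : ∑ j, C i j * v j = 0 := congrFun (LinearMap.mem_ker.1 hv) i
  simp only [mul_div_assoc', ← Finset.sum_div, mul_sub, Finset.sum_sub_distrib, hvi,
    ← Finset.sum_mul, h1, zero_mul, sub_zero, zero_div]

/-- Over the complex numbers the kernel of `C` is spanned by `1` and `w`. -/
theorem IsGaleDual.mem_ker {n : ℕ} {C : Matrix (Fin n) (Fin (n + 1 + 1)) ℂ}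
    {w : Fin (n + 1 + 1) → ℂ} {l : Fin (n + 1 + 1)} (h : IsGaleDual C w l)
    {v : Fin (n + 1 + 1) → ℂ} (hv : C.mulVec v = 0) (j : Fin (n + 1 + 1)) :
    v j = v 0 + w j * (v l - v 0) := by
  have hli : LinearIndependent ℂ ![(1 : Fin (n + 1 + 1) → ℂ), w] := by
    rw [LinearIndependent.pair_iff]
    intro s t hst
    have h0 := congrFun hst 0
    have hl := congrFun hst l
    simp [h.zero, h.one] at h0 hl
    exact ⟨h0, by simpa [h0] using hl⟩
  have hle : Submodule.span ℂ (Set.range ![(1 : Fin (n + 1 + 1) → ℂ), w]) ≤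
      LinearMap.ker C.mulVecLin := by
    rw [Submodule.span_le]
    rintro _ ⟨i, rfl⟩
    fin_cases i
    · ext i; simpa [Matrix.mulVec, dotProduct] using h.sum_eq i
    · ext i; simpa [Matrix.mulVec, dotProduct] using h.sum_mul i
  have heq := Submodule.eq_of_le_of_finrank_eq hle
    (by rw [finrank_ker_mulVecLin h.rank, finrank_span_eq_card hli]; simp)
  have hmem : v ∈ Submodule.span ℂ (Set.range ![(1 : Fin (n + 1 + 1) → ℂ), w]) := by
    rw [heq]; exact LinearMap.mem_ker.2 hv
  simp only [Matrix.range_cons, Matrix.range_empty, Set.union_empty, Set.singleton_union] at hmem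
  obtain ⟨s, t, rfl⟩ := Submodule.mem_span_pair.1 hmem
  simp [h.zero, h.one]; ring

/-- Over every commutative algebra the kernel of `C` is spanned by `1` and `w`. -/
theorem IsGaleDual.eq_of_ker {n : ℕ} {C : Matrix (Fin n) (Fin (n + 1 + 1)) ℂ}
    {w : Fin (n + 1 + 1) → ℂ} {l : Fin (n + 1 + 1)} (h : IsGaleDual C w l)
    {R : Type*} [CommRing R] [Algebra ℂ R] {u : Fin (n + 1 + 1) → R}
    (hu : ∀ i, ∑ j, C i j • u j = 0) (j : Fin (n + 1 + 1)) :
    u j = u 0 + w j • (u l - u 0) := by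
  let e : Fin (n + 1 + 1) → Module.Dual ℂ (Fin (n + 1 + 1) → ℂ) := fun j => LinearMap.proj j
  -- This functional vanishes on the kernel of `C`, so it is a complex combination of the rows of
  -- `C`. The same combination of the hypotheses `hu` then makes sense over `R`.
  have hmem : e j - e 0 - w j • (e l - e 0) ∈ LinearMap.range C.mulVecLin.dualMap := by
    rw [LinearMap.range_dualMap_eq_dualAnnihilator_ker, Submodule.mem_dualAnnihilator]
    intro v hv
    have := h.mem_ker (LinearMap.mem_ker.1 hv) j
    simp only [e, LinearMap.sub_apply, LinearMap.smul_apply, LinearMap.proj_apply, smul_eq_mul]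
    linear_combination this
  obtain ⟨g, hg⟩ := hmem
  classical
  have hD : ∀ k, ∑ i, g (Pi.single i 1) * C i k =
      (e j - e 0 - w j • (e l - e 0)) (Pi.single k 1) := by
    intro k
    rw [← hg, LinearMap.dualMap_apply, Matrix.mulVecLin_apply, Matrix.mulVec_single_one]
    conv_rhs => rw [LinearMap.pi_apply_eq_sum_univ g]
    refine Finset.sum_congr rfl fun i _ => ?_
    have hs : (Pi.single i 1 : Fin n → ℂ) = fun j => if i = j then 1 else 0 := by
      ext j; simp [Pi.single_apply, eq_comm]
    rw [hs, smul_eq_mul, mul_comm, Matrix.col_apply]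
  have hsum : ∑ k, (∑ i, g (Pi.single i 1) * C i k) • u k = 0 := by
    simp only [Finset.sum_smul, mul_smul]
    rw [Finset.sum_comm]
    exact Finset.sum_eq_zero fun i _ => by rw [← Finset.smul_sum, hu, smul_zero]
  simp only [hD, e, LinearMap.sub_apply, LinearMap.smul_apply, LinearMap.proj_apply, smul_eq_mul,
    sub_smul, mul_smul, Finset.sum_sub_distrib, ← Finset.smul_sum, Pi.single_apply, ite_smul,
    one_smul, zero_smul, Finset.sum_ite_eq, Finset.mem_univ, if_true] at hsum
  rw [← sub_eq_zero, ← sub_sub, hsum]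

theorem single_add_one {n : ℕ} (α β : Fin n → ℤ) :
    (AddMonoidAlgebra.single (α + β) 1 : Laurent n) =
      AddMonoidAlgebra.single α 1 * AddMonoidAlgebra.single β 1 := by
  rw [AddMonoidAlgebra.single_mul_single, one_mul]

theorem map_single_sum {n : ℕ} {R : Type*} [CommRing R] [Algebra ℂ R] (φ : Laurent n →ₐ[ℂ] R)
    {ι : Type*} (s : Finset ι) (c : ι → ℕ) (v : ι → Fin n → ℤ) :
    φ (AddMonoidAlgebra.single (∑ j ∈ s, c j • v j) 1) =
      ∏ j ∈ s, φ (AddMonoidAlgebra.single (v j) 1) ^ c j := by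
  classical
  induction s using Finset.induction_on with
  | empty => simp [← AddMonoidAlgebra.one_def]
  | insert x s hx ih =>
    rw [Finset.sum_insert hx, Finset.prod_insert hx, single_add_one, map_mul, ih, ← map_pow,
      AddMonoidAlgebra.single_pow, one_pow]

/-- An integer affine relation between the points `a j`. -/
structure IsAffineRelation {n N : ℕ} (a : Fin N → Fin n → ℤ) (r : Fin N → ℤ) : Prop where
  sum_eq : ∑ j, r j = 0
  sum_smul : ∑ j, r j • a j = 0

theorem isAffineRelation_minorRel {n : ℕ} (a : Fin (n + 1 + 1) → Fin n → ℤ) :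
    IsAffineRelation a (minorRel a) :=
  ⟨sum_minorRel a, sum_minorRel_smul a⟩

section Characters

variable {n : ℕ} {a : Fin (n + 1 + 1) → Fin n → ℤ} {C : Matrix (Fin n) (Fin (n + 1 + 1)) ℂ}
  {w : Fin (n + 1 + 1) → ℂ} {l : Fin (n + 1 + 1)} {R : Type*} [CommRing R] [Algebra ℂ R]

/-- The Gale dual parameter of a solution of the system in a commutative algebra. -/
def galeParam (a : Fin (n + 1 + 1) → Fin n → ℤ) (l : Fin (n + 1 + 1)) : Laurent n :=
  AddMonoidAlgebra.single (a l - a 0) 1 - 1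

/-- Dividing the system by the monomial of `a 0` turns the monomials of `a j - a 0` into a kernel
vector of `C` over `R` whose entry at `0` is `1`. -/
theorem IsGaleDual.map_single (h : IsGaleDual C w l) {φ : Laurent n →ₐ[ℂ] R}
    (hφ : ∀ i, φ (poly a C i) = 0) (j : Fin (n + 1 + 1)) :
    φ (AddMonoidAlgebra.single (a j - a 0) 1) = 1 + w j • φ (galeParam a l) := by
  have h0 : φ (AddMonoidAlgebra.single (a 0 - a 0) 1) = 1 := by
    rw [sub_self, ← AddMonoidAlgebra.one_def, map_one]
  have := h.eq_of_ker (u := fun j => φ (AddMonoidAlgebra.single (a j - a 0) 1)) (fun i => ?_) j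
  · simp only [h0] at this
    rw [this, galeParam, map_sub, map_one]
  · have hp : ∑ j, C i j • φ (AddMonoidAlgebra.single (a j - a 0) 1) =
        φ (poly a C i * AddMonoidAlgebra.single (-a 0) 1) := by
      rw [poly, Finset.sum_mul, map_sum]
      refine Finset.sum_congr rfl fun j _ => ?_
      rw [← map_smul, AddMonoidAlgebra.single_mul_single, AddMonoidAlgebra.smul_single,
        smul_eq_mul, sub_eq_add_neg]
    rw [hp, map_mul, hφ, zero_mul]

theorem IsGaleDual.aeval_relProd (h : IsGaleDual C w l) {φ : Laurent n →ₐ[ℂ] R}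
    (hφ : ∀ i, φ (poly a C i) = 0) (c : Fin (n + 1 + 1) → ℕ) :
    Polynomial.aeval (φ (galeParam a l)) (relProd w c) =
      φ (AddMonoidAlgebra.single (∑ j, c j • (a j - a 0)) 1) := by
  rw [map_single_sum, relProd, map_prod]
  refine Finset.prod_congr rfl fun j _ => ?_
  rw [h.map_single hφ]
  simp [Algebra.smul_def]

/-- The positive and negative parts of `r` have the same weighted sum of the `a j - a 0`, so both
products of binomials are the image of a single monomial. -/
theorem IsGaleDual.aeval_relPoly (h : IsGaleDual C w l) {φ : Laurent n →ₐ[ℂ] R}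
    (hφ : ∀ i, φ (poly a C i) = 0) {r : Fin (n + 1 + 1) → ℤ} (hr : IsAffineRelation a r) :
    Polynomial.aeval (φ (galeParam a l)) (relPoly w r) = 0 := by
  rw [relPoly, map_sub, h.aeval_relProd hφ, h.aeval_relProd hφ, sub_eq_zero]
  congr 2
  rw [← sub_eq_zero, ← Finset.sum_sub_distrib]
  have : ∀ j, (r j).toNat • (a j - a 0) - (-r j).toNat • (a j - a 0) = r j • a j - r j • a 0 := by
    intro j
    rw [← natCast_zsmul, ← natCast_zsmul, ← sub_smul, Int.toNat_sub_toNat_neg, smul_sub]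
  rw [Finset.sum_congr rfl fun j _ => this j, Finset.sum_sub_distrib, hr.sum_smul,
    ← Finset.sum_smul, hr.sum_eq, zero_smul, sub_zero]

end Characters

/-! ### Finiteness and isolation of solutions -/

/-- The rows of the left inverse `B` after the first have sum zero, because `augMatrix a` has a
column of ones. They therefore write `d` times each basis vector through the differences `a j - a
0`. -/
theorem IsConfiguration.exists_smul_mem_closure {n N : ℕ} {a : Fin (N + 1) → Fin n → ℤ}
    (ha : IsConfiguration a) :
    ∃ d : ℕ, d ≠ 0 ∧ ∀ α : Fin n → ℤ,
      d • α ∈ AddSubgroup.closure (Set.range fun j => a j - a 0) := by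
  obtain ⟨d, hd, B, hB⟩ := ha.exists_leftInverse
  refine ⟨d.natAbs, Int.natAbs_ne_zero.2 hd, fun α => ?_⟩
  have hmem : d • α ∈ AddSubgroup.closure (Set.range fun j => a j - a 0) := by
    have h0 : ∀ k : Fin n, ∑ j, B k.succ j = 0 := by
      intro k
      have := congrFun (congrFun hB k.succ) 0
      simpa [Matrix.mul_apply, augMatrix, Matrix.one_apply] using this
    have h1 : ∀ k i : Fin n, ∑ j, B k.succ j * a j i = if k = i then d else 0 := by
      intro k i
      have := congrFun (congrFun hB k.succ) i.succ
      simpa [Matrix.mul_apply, augMatrix, Matrix.one_apply] using this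
    have hα : d • α = ∑ k : Fin n, α k • ∑ j, B k.succ j • (a j - a 0) := by
      funext i
      have : ∀ k : Fin n, ∑ j, B k.succ j • (a j - a 0) = ∑ j, B k.succ j • a j := by
        intro k
        simp only [smul_sub, Finset.sum_sub_distrib, ← Finset.sum_smul, h0, zero_smul, sub_zero]
      simp only [this]
      simp [Finset.sum_apply, h1]
      ring
    rw [hα]
    exact AddSubgroup.sum_mem _ fun k _ => AddSubgroup.zsmul_mem _
      (AddSubgroup.sum_mem _ fun j _ => AddSubgroup.zsmul_mem _
        (AddSubgroup.subset_closure (Set.mem_range_self j)) _) _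
  rcases Int.natAbs_eq d with h | h
  · rw [h] at hmem; simpa using hmem
  · rw [h] at hmem; simpa using hmem

theorem evalAt_single {n : ℕ} (q : Fin n → ℂˣ) (α : Fin n → ℤ) :
    evalAt q (AddMonoidAlgebra.single α 1) = ((∏ i, q i ^ α i : ℂˣ) : ℂ) := by
  rw [evalAt, AddMonoidAlgebra.lift_single, one_smul]
  rfl

/-- The monomials of a point as a group homomorphism. -/
def monomialHom {n : ℕ} (q : Fin n → ℂˣ) : (Fin n → ℤ) →+ Additive ℂˣ where
  toFun α := Additive.ofMul (∏ i, q i ^ α i)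
  map_zero' := by simp
  map_add' α β := by simp [zpow_add, Finset.prod_mul_distrib]

theorem monomialHom_apply {n : ℕ} (q : Fin n → ℂˣ) (α : Fin n → ℤ) :
    (((monomialHom q α).toMul : ℂˣ) : ℂ) = evalAt q (AddMonoidAlgebra.single α 1) :=
  (evalAt_single q α).symm

/-- The parameter is a root of `relPoly w r`. It fixes all monomials in the lattice of differences,
hence each `q i ^ d`, which leaves finitely many `q`. -/
theorem IsGaleDual.finite_solutions {n : ℕ} {a : Fin (n + 1 + 1) → Fin n → ℤ}
    {C : Matrix (Fin n) (Fin (n + 1 + 1)) ℂ} {w : Fin (n + 1 + 1) → ℂ} {l : Fin (n + 1 + 1)}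
    (h : IsGaleDual C w l) (ha : IsConfiguration a) {r : Fin (n + 1 + 1) → ℤ}
    (hr : IsAffineRelation a r) (hP : relPoly w r ≠ 0) : (solutions a C).Finite := by
  obtain ⟨d, hd, hcl⟩ := ha.exists_smul_mem_closure
  refine Set.Finite.of_finite_fibers (fun q => evalAt q (galeParam a l)) ?_ ?_
  · refine (Polynomial.rootSet_finite (relPoly w r) ℂ).subset ?_
    rintro _ ⟨q, hq, rfl⟩
    rw [Polynomial.mem_rootSet]
    exact ⟨hP, h.aeval_relPoly hq hr⟩
  · rintro _ ⟨q, hq, rfl⟩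
    refine (Set.Finite.pi' (t := fun i => {z : ℂˣ | z ^ d = q i ^ d}) fun i => ?_).subset ?_
    · refine Set.Finite.of_finite_image (f := fun z : ℂˣ => (z : ℂ)) ?_ Units.val_injective.injOn
      refine (Multiset.finite_toSet (Polynomial.nthRoots d ((q i : ℂ) ^ d))).subset ?_
      rintro _ ⟨z, hz, rfl⟩
      rw [Set.mem_ofPred_eq, Polynomial.mem_nthRoots (Nat.pos_of_ne_zero hd)]
      simpa using congrArg Units.val hz
    · rintro q' ⟨hq', hqq⟩ i
      rw [Set.mem_preimage, Set.mem_singleton_iff] at hqq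
      have heq : Set.EqOn (monomialHom q') (monomialHom q)
          (AddSubgroup.closure (Set.range fun j => a j - a 0)) := by
        refine AddMonoidHom.eqOn_closure ?_
        rintro _ ⟨j, rfl⟩
        apply Additive.toMul.injective
        apply Units.ext
        simp only [] at hqq
        rw [monomialHom_apply, monomialHom_apply, h.map_single hq', h.map_single hq, hqq]
      have := heq (hcl (Pi.single i 1))
      have h2 : ∀ p : Fin n → ℂˣ, monomialHom p (Pi.single i 1) = Additive.ofMul (p i) := by
        intro p
        change Additive.ofMul _ = _
        congr 1
        rw [Finset.prod_eq_single i] <;> simp +contextual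
      rw [map_nsmul, map_nsmul, h2, h2] at this
      exact this

theorem IsGaleDual.isIsolatedSolution_one {n : ℕ} {a : Fin (n + 1 + 1) → Fin n → ℤ}
    {C : Matrix (Fin n) (Fin (n + 1 + 1)) ℂ} {w : Fin (n + 1 + 1) → ℂ} {l : Fin (n + 1 + 1)}
    (h : IsGaleDual C w l) (ha : IsConfiguration a) {r : Fin (n + 1 + 1) → ℤ}
    (hr : IsAffineRelation a r) (hP : relPoly w r ≠ 0) : IsIsolatedSolution a C 1 := by
  refine ⟨(solutions a C \ {1})ᶜ,
    ((h.finite_solutions ha hr hP).subset Set.sdiff_subset).isClosed.isOpen_compl.mem_nhds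
      (by simp), ?_⟩
  have h1 : (1 : Fin n → ℂˣ) ∈ solutions a C := fun i => by
    rw [evalAt_poly]; simpa using h.sum_eq i
  ext q
  simp only [Set.mem_inter_iff, Set.mem_compl_iff, Set.mem_sdiff, Set.mem_singleton_iff]
  constructor
  · rintro ⟨h2, h3⟩; by_contra h4; exact h2 ⟨h3, h4⟩
  · rintro rfl; exact ⟨fun h => h.2 rfl, h1⟩

/-- For every `y` the vector of `log (1 + w j * y)` is orthogonal to `minorRel a`, hence an affine
function of `a j`. The exponentials of its slopes form a curve of solutions that tends to `1` as `y`
tends to `0`. -/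
theorem IsGaleDual.not_isIsolatedSolution {n : ℕ} {a : Fin (n + 1 + 1) → Fin n → ℤ}
    {C : Matrix (Fin n) (Fin (n + 1 + 1)) ℂ} {w : Fin (n + 1 + 1) → ℂ} {l : Fin (n + 1 + 1)}
    (h : IsGaleDual C w l) (ha : IsConfiguration a)
    (hw : ∀ k < n + 1 + 1, ∑ j, (minorRel a j : ℂ) * w j ^ k = 0) :
    ¬ IsIsolatedSolution a C 1 := by
  rintro ⟨U, hU, hUq⟩
  obtain ⟨d, hd, B, hB⟩ := ha.exists_leftInverse
  -- The slopes, recovered by the left inverse `B / d`; the explicit formula gives continuity at `y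
  -- = 0`.
  let θ : ℂ → Fin n → ℂ := fun y k => (∑ j, (B k.succ j : ℂ) * Complex.log (1 + w j * y)) / d
  let E : ℂ → ℂˣ := fun z => Units.mk0 (Complex.exp z) (Complex.exp_ne_zero z)
  have hE : Continuous E := by
    rw [Units.continuous_iff]
    refine ⟨Complex.continuous_exp, ?_⟩
    have : (fun z => ((E z)⁻¹ : ℂˣ).val) = fun z => Complex.exp (-z) := by
      funext z; simp [E, Complex.exp_neg]
    change Continuous (fun z => ((E z)⁻¹ : ℂˣ).val)
    rw [this]; fun_prop
  have hθ : ∀ y, ∀ j, ∑ k, (a j k : ℂ) * θ y k =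
      Complex.log (1 + w j * y) + ∑ k, (a 0 k : ℂ) * θ y k := by
    intro y
    obtain ⟨v, hv⟩ := exists_affine_of_sum_minorRel ha (fun j => Complex.log (1 + w j * y))
      (sum_mul_apply_eq_zero w _ hw (fun z => Complex.log (1 + z * y)))
    have hθv : ∀ k, θ y k = v k.succ := by
      intro k
      have hd' : (d : ℂ) ≠ 0 := by exact_mod_cast hd
      rw [div_eq_iff hd']
      have h2 : ∑ j, (B k.succ j : ℂ) * ∑ k, (augMatrix a j k : ℂ) * v k =
          ∑ i, (((B * augMatrix a) k.succ i : ℤ) : ℂ) * v i := by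
        simp only [Finset.mul_sum, Matrix.mul_apply, Int.cast_sum, Finset.sum_mul, Int.cast_mul]
        rw [Finset.sum_comm]
        simp only [mul_assoc]
      simp only [hv]
      rw [h2, hB]
      simp [Matrix.one_apply, mul_comm]
    have hvj : ∀ j, Complex.log (1 + w j * y) = v 0 + ∑ k, (a j k : ℂ) * v k.succ := by
      intro j
      have := hv j
      simpa [Fin.sum_univ_succ (n := n), augMatrix] using this
    intro j
    have h0 := hvj 0
    rw [h.zero, zero_mul, add_zero, Complex.log_one] at h0
    simp only [hθv, hvj j]
    linear_combination h0
  have hmon : ∀ y, ∀ j, ∏ k, ((E (θ y k) : ℂˣ) : ℂ) ^ a j k =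
      Complex.exp (∑ k, (a j k : ℂ) * θ y k) := by
    intro y j
    rw [Complex.exp_sum]
    exact Finset.prod_congr rfl fun k _ => by simp [E, Complex.exp_int_mul]
  have hlim : Filter.Tendsto (fun y k => E (θ y k)) (𝓝 0) (𝓝 1) := by
    rw [tendsto_pi_nhds]
    intro k
    have hc : ContinuousAt (fun y => θ y k) 0 := by
      refine ContinuousAt.div_const (tendsto_finsetSum _ fun j _ => ?_) _
      have hlin : ContinuousAt (fun y : ℂ => 1 + w j * y) 0 := by fun_prop
      exact continuousAt_const.mul (hlin.clog (by simp))
    have := hE.continuousAt.comp hc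
    have h0 : E (θ 0 k) = 1 := by ext; simp [E, θ]
    rw [ContinuousAt, Function.comp_apply, h0] at this
    exact this
  have hne : ∀ᶠ y : ℂ in 𝓝 0, ∀ j, 1 + w j * y ≠ 0 := by
    rw [Filter.eventually_all]
    intro j
    have : ContinuousAt (fun y : ℂ => 1 + w j * y) 0 := by fun_prop
    exact this.eventually_ne (by simp)
  obtain ⟨y, ⟨hyU, hyne⟩, hy0⟩ :=
    ((((hlim.eventually hU).and hne).filter_mono nhdsWithin_le_nhds).and
      (self_mem_nhdsWithin (s := {(0 : ℂ)}ᶜ))).exists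
  have hexp : ∀ j, ∏ k, ((E (θ y k) : ℂˣ) : ℂ) ^ a j k =
      (1 + w j * y) * Complex.exp (∑ k, (a 0 k : ℂ) * θ y k) := by
    intro j
    rw [hmon, hθ, Complex.exp_add, Complex.exp_log (hyne j)]
  have hsol : (fun k => E (θ y k)) ∈ U ∩ solutions a C := by
    refine ⟨hyU, fun i => ?_⟩
    rw [evalAt_poly]
    have h2 : ∀ j, C i j * ((1 + w j * y) * Complex.exp (∑ k, (a 0 k : ℂ) * θ y k)) =
        (C i j + C i j * w j * y) * Complex.exp (∑ k, (a 0 k : ℂ) * θ y k) := fun j => by ring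
    simp only [hexp, h2, ← Finset.sum_mul, Finset.sum_add_distrib, h.sum_eq, h.sum_mul]
    simp
  rw [hUq, Set.mem_singleton_iff] at hsol
  -- If the point of the curve were `1`, comparing the monomials of `a l` and `a 0` would give `1 +
  -- y = 1`, although `y ≠ 0`.
  have h1 : ∀ k, E (θ y k) = 1 := fun k => congrFun hsol k
  have hl := hexp l
  have h0 := hexp 0
  simp only [h1, h.one, h.zero, Units.val_one, one_zpow, Finset.prod_const_one, one_mul, zero_mul,
    add_zero] at hl h0
  rw [← h0, mul_one] at hl
  exact hy0 (by simpa using hl.symm)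

/-! ### Upper bound for the local algebra -/

/-- If the maximal ideal is generated by `τ` modulo `I` and a polynomial in `τ` of order at most
`m` vanishes modulo `I`, then the quotient by `I` has dimension at most `m`. -/
theorem rank_quotient_le {O : Type*} [CommRing O] [IsLocalRing O] [Algebra ℂ O]
    (hres : ∀ x : O, ∃ c : ℂ, x - algebraMap ℂ O c ∈ IsLocalRing.maximalIdeal O)
    (I : Ideal O) (τ : O) (hτ : τ ∈ IsLocalRing.maximalIdeal O)
    (hm : IsLocalRing.maximalIdeal O ≤ Ideal.span {τ} ⊔ I) (P : Polynomial ℂ)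
    (hP : Polynomial.aeval τ P ∈ I) {m : ℕ} (hPm : ¬ Polynomial.X ^ (m + 1) ∣ P) :
    Module.rank ℂ (O ⧸ I) ≤ m := by
  have hP0 : P ≠ 0 := fun h => hPm (h ▸ dvd_zero _)
  obtain ⟨Q, hQ, hQ0⟩ := Polynomial.exists_eq_pow_rootMultiplicity_mul_and_not_dvd P hP0 0
  set k := Polynomial.rootMultiplicity 0 P
  rw [map_zero, sub_zero] at hQ hQ0
  have hk : k ≤ m := by
    by_contra hlt
    exact hPm (hQ ▸ ((pow_dvd_pow _ (by omega)).mul_right _))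
  -- `Q` at `τ` is congruent to `Q.coeff 0 ≠ 0` modulo the maximal ideal. Cancelling this unit
  -- leaves `τ ^ k ∈ I`.
  have hQu : IsUnit (Polynomial.aeval τ Q) := by
    have h1 : Polynomial.aeval τ Q - algebraMap ℂ O (Q.coeff 0) ∈ IsLocalRing.maximalIdeal O := by
      have h2 := congrArg (Polynomial.aeval τ) (Polynomial.divX_mul_X_add Q)
      rw [map_add, map_mul, Polynomial.aeval_X, Polynomial.aeval_C] at h2
      rw [← h2, add_sub_cancel_right]
      exact Ideal.mul_mem_left _ _ hτ
    by_contra hu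
    have h2 := (IsLocalRing.mem_maximalIdeal _).2 hu
    have h3 := sub_mem h2 h1
    rw [sub_sub_cancel] at h3
    rw [Polynomial.X_dvd_iff] at hQ0
    exact (IsLocalRing.mem_maximalIdeal _).1 h3 ((IsUnit.mk0 _ hQ0).map (algebraMap ℂ O))
  have hτk : τ ^ k ∈ I := by
    rw [hQ, map_mul, map_pow, Polynomial.aeval_X] at hP
    obtain ⟨u, hu⟩ := hQu
    have := I.mul_mem_right (↑u⁻¹ : O) hP
    rwa [← hu, mul_assoc, Units.mul_inv, mul_one] at this
  set t : O ⧸ I := Ideal.Quotient.mk I τ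
  let V : ℕ → Submodule ℂ (O ⧸ I) := fun j => Submodule.span ℂ (Set.range fun i : Fin j => t ^ (i : ℕ))
  -- Iterating this splitting expands every class in powers of `t`; the expansion stops at `t ^ k =
  -- 0`.
  have hstep : ∀ y : O ⧸ I, ∃ c : ℂ, ∃ z, y = algebraMap ℂ _ c + t * z := by
    intro y
    obtain ⟨x, rfl⟩ := Ideal.Quotient.mk_surjective y
    obtain ⟨c, hc⟩ := hres x
    obtain ⟨u, hu, v, hv, huv⟩ := Submodule.mem_sup.1 (hm hc)
    obtain ⟨s, rfl⟩ := Ideal.mem_span_singleton'.1 hu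
    refine ⟨c, Ideal.Quotient.mk I s, ?_⟩
    have hx : x = algebraMap ℂ O c + (s * τ + v) := by rw [huv]; ring
    rw [hx, map_add, map_add, map_mul, Ideal.Quotient.eq_zero_iff_mem.2 hv, add_zero, mul_comm]
    rfl
  have hexp : ∀ j, ∀ y : O ⧸ I, ∃ v ∈ V j, ∃ z, y = v + t ^ j * z := by
    intro j
    induction j with
    | zero => exact fun y => ⟨0, zero_mem _, y, by simp⟩
    | succ j ih =>
      intro y
      obtain ⟨v, hv, z, rfl⟩ := ih y
      obtain ⟨c, z', rfl⟩ := hstep z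
      refine ⟨v + c • t ^ j, ?_, z', ?_⟩
      · refine add_mem (Submodule.span_mono ?_ hv) (Submodule.smul_mem _ _
          (Submodule.subset_span ⟨Fin.last j, rfl⟩))
        rintro _ ⟨i, rfl⟩
        exact ⟨i.castSucc, rfl⟩
      · rw [Algebra.smul_def]; ring
  have htop : V k = ⊤ := by
    rw [eq_top_iff]
    intro y _
    obtain ⟨v, hv, z, rfl⟩ := hexp k y
    have : t ^ k = 0 := by rw [← map_pow]; exact Ideal.Quotient.eq_zero_iff_mem.2 hτk
    rwa [this, zero_mul, add_zero]
  calc Module.rank ℂ (O ⧸ I) = Module.rank ℂ (V k) := by rw [htop, rank_top]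
    _ ≤ Cardinal.mk (Set.range fun i : Fin k => t ^ (i : ℕ)) := rank_span_le _
    _ ≤ k := by simpa using Cardinal.mk_range_le_lift (f := fun i : Fin k => t ^ (i : ℕ))
    _ ≤ m := by exact_mod_cast hk

/-- Evaluation at `q` on the local ring at `q`. -/
def evalLocal {n : ℕ} (q : Fin n → ℂˣ) : Localization.AtPrime (pointIdeal q) →+* ℂ :=
  IsLocalization.lift (M := (pointIdeal q).primeCompl) (g := (evalAt q : Laurent n →+* ℂ))
    (fun y => IsUnit.mk0 _ y.2)

theorem evalLocal_algebraMap {n : ℕ} (q : Fin n → ℂˣ) (f : Laurent n) :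
    evalLocal q (algebraMap _ _ f) = evalAt q f :=
  IsLocalization.lift_eq _ f

theorem exists_sub_algebraMap_mem_maximalIdeal {n : ℕ} (q : Fin n → ℂˣ)
    (x : Localization.AtPrime (pointIdeal q)) :
    ∃ c : ℂ, x - algebraMap ℂ _ c ∈
      IsLocalRing.maximalIdeal (Localization.AtPrime (pointIdeal q)) := by
  refine ⟨evalLocal q x, IsLocalRing.le_maximalIdeal (RingHom.ker_ne_top (evalLocal q)) ?_⟩
  rw [RingHom.mem_ker, map_sub, IsScalarTower.algebraMap_apply ℂ (Laurent n), evalLocal_algebraMap,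
    AlgHom.commutes, Algebra.algebraMap_self_apply, sub_self]

theorem algebraMap_mem_maximalIdeal {n : ℕ} {q : Fin n → ℂˣ} {f : Laurent n}
    (hf : evalAt q f = 0) : algebraMap _ _ f ∈
      IsLocalRing.maximalIdeal (Localization.AtPrime (pointIdeal q)) :=
  IsLocalRing.le_maximalIdeal (RingHom.ker_ne_top (evalLocal q))
    (by rw [RingHom.mem_ker, evalLocal_algebraMap, hf])

theorem evalAt_one_single {n : ℕ} (α : Fin n → ℤ) :
    evalAt 1 (AddMonoidAlgebra.single α 1 : Laurent n) = 1 := by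
  rw [evalAt_single]; simp

/-- With parameter zero, every monomial in the lattice of differences maps to `1`, so any monomial
maps to some `z` with `z ^ d = 1`. The sum `1 + z + ⋯ + z ^ (d - 1)` comes from an element with
value `d ≠ 0` at `1`, hence is a unit, and `z = 1`. -/
theorem IsGaleDual.eq_algebraMap_evalAt {n : ℕ} {a : Fin (n + 1 + 1) → Fin n → ℤ}
    {C : Matrix (Fin n) (Fin (n + 1 + 1)) ℂ} {w : Fin (n + 1 + 1) → ℂ} {l : Fin (n + 1 + 1)}
    (h : IsGaleDual C w l) (ha : IsConfiguration a) {R : Type*} [CommRing R] [Algebra ℂ R]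
    {φ : Laurent n →ₐ[ℂ] R} (hφ : ∀ i, φ (poly a C i) = 0) (hpar : φ (galeParam a l) = 0)
    (hunit : ∀ f, evalAt 1 f ≠ 0 → IsUnit (φ f)) (f : Laurent n) :
    φ f = algebraMap ℂ R (evalAt 1 f) := by
  obtain ⟨d, hd, hcl⟩ := ha.exists_smul_mem_closure
  have hcl1 : ∀ α ∈ AddSubgroup.closure (Set.range fun j => a j - a 0),
      φ (AddMonoidAlgebra.single α 1) = 1 := by
    intro α hα
    induction hα using AddSubgroup.closure_induction with
    | mem x hx =>
      obtain ⟨j, rfl⟩ := hx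
      have := h.map_single hφ j
      rwa [hpar, smul_zero, add_zero] at this
    | zero => rw [← AddMonoidAlgebra.one_def, map_one]
    | add x y _ _ hx hy => rw [single_add_one, map_mul, hx, hy, one_mul]
    | neg x _ hx =>
      have h1 : φ (AddMonoidAlgebra.single (x + -x) 1) = 1 := by
        rw [add_neg_cancel, ← AddMonoidAlgebra.one_def, map_one]
      rwa [single_add_one, map_mul, hx, one_mul] at h1
  have hone : ∀ α, φ (AddMonoidAlgebra.single α 1) = 1 := by
    intro α
    have h1 : φ (AddMonoidAlgebra.single α 1) ^ d = 1 := by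
      rw [← map_pow, AddMonoidAlgebra.single_pow, one_pow, hcl1 _ (hcl α)]
    have hu := hunit (∑ i ∈ Finset.range d, AddMonoidAlgebra.single α 1 ^ i) (by
      simp only [map_sum, map_pow, evalAt_one_single, one_pow, Finset.sum_const, Finset.card_range,
        nsmul_eq_mul, mul_one]
      exact_mod_cast hd)
    have h3 := mul_geom_sum (φ (AddMonoidAlgebra.single α 1)) d
    rw [h1, sub_self] at h3
    rw [map_sum] at hu
    simp only [map_pow] at hu
    exact sub_eq_zero.1 (hu.mul_left_eq_zero.1 h3)
  have : φ = (Algebra.ofId ℂ R).comp (evalAt 1) := by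
    refine AddMonoidAlgebra.algHom_ext (fun α => ?_) (by ext)
    rw [hone, AlgHom.comp_apply, evalAt_one_single, map_one]
  rw [this]; rfl

/-- The algebra homomorphism from Laurent polynomials to a quotient of a localization. -/
def toQuotient {n : ℕ} {O : Type*} [CommRing O] [Algebra ℂ O] [Algebra (Laurent n) O]
    [IsScalarTower ℂ (Laurent n) O] (J : Ideal O) : Laurent n →ₐ[ℂ] O ⧸ J :=
  (Ideal.Quotient.mkₐ ℂ J).comp (IsScalarTower.toAlgHom ℂ (Laurent n) O)

theorem toQuotient_apply {n : ℕ} {O : Type*} [CommRing O] [Algebra ℂ O] [Algebra (Laurent n) O]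
    [IsScalarTower ℂ (Laurent n) O] (J : Ideal O) (f : Laurent n) :
    toQuotient J f = Ideal.Quotient.mk J (algebraMap (Laurent n) O f) := rfl

section LocalRing

variable {n : ℕ} {O : Type*} [CommRing O] [Algebra ℂ O] [Algebra (Laurent n) O]
    [IsScalarTower ℂ (Laurent n) O] {a : Fin (n + 1 + 1) → Fin n → ℤ}
    {C : Matrix (Fin n) (Fin (n + 1 + 1)) ℂ} {w : Fin (n + 1 + 1) → ℂ} {l : Fin (n + 1 + 1)}

theorem toQuotient_poly {J : Ideal O} (hJ : (systemIdeal a C).map (algebraMap (Laurent n) O) ≤ J)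
    (i : Fin n) : toQuotient J (poly a C i) = 0 := by
  rw [toQuotient_apply, Ideal.Quotient.eq_zero_iff_mem]
  exact hJ (Ideal.mem_map_of_mem _ (Ideal.subset_span ⟨i, rfl⟩))

/-- Modulo the system and the parameter, every Laurent polynomial equals its value at `1`. For the
local ring this says that the parameter generates the maximal ideal modulo the system. -/
theorem IsGaleDual.map_pointIdeal_le (h : IsGaleDual C w l) (ha : IsConfiguration a)
    (hunit : ∀ f : Laurent n, evalAt 1 f ≠ 0 → IsUnit (algebraMap (Laurent n) O f)) :
    (pointIdeal (1 : Fin n → ℂˣ)).map (algebraMap (Laurent n) O) ≤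
      Ideal.span {algebraMap (Laurent n) O (galeParam a l)} ⊔
        (systemIdeal a C).map (algebraMap (Laurent n) O) := by
  set J : Ideal O := Ideal.span {algebraMap (Laurent n) O (galeParam a l)} ⊔
        (systemIdeal a C).map (algebraMap (Laurent n) O)
  rw [Ideal.map_le_iff_le_comap]
  intro f hf
  rw [Ideal.mem_comap, ← Ideal.Quotient.eq_zero_iff_mem, ← toQuotient_apply,
    h.eq_algebraMap_evalAt ha (toQuotient_poly le_sup_right) ?_ (fun f hf => ?_),
    show evalAt 1 f = 0 from hf, map_zero]
  · rw [toQuotient_apply, Ideal.Quotient.eq_zero_iff_mem]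
    exact (le_sup_left : _ ≤ J) (Ideal.subset_span rfl)
  · exact (hunit f hf).map (Ideal.Quotient.mk J)

theorem IsGaleDual.aeval_relPoly_mem (h : IsGaleDual C w l) {r : Fin (n + 1 + 1) → ℤ}
    (hr : IsAffineRelation a r) :
    Polynomial.aeval (algebraMap (Laurent n) O (galeParam a l)) (relPoly w r) ∈
      (systemIdeal a C).map (algebraMap (Laurent n) O) := by
  set I := (systemIdeal a C).map (algebraMap (Laurent n) O)
  have := h.aeval_relPoly (toQuotient_poly (J := I) le_rfl) hr
  rw [← Ideal.Quotient.eq_zero_iff_mem, ← this]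
  exact (Polynomial.aeval_algHom_apply (Ideal.Quotient.mkₐ ℂ I) _ _).symm

end LocalRing

theorem IsGaleDual.rank_localAlgebra_le {n : ℕ} {a : Fin (n + 1 + 1) → Fin n → ℤ}
    {C : Matrix (Fin n) (Fin (n + 1 + 1)) ℂ} {w : Fin (n + 1 + 1) → ℂ} {l : Fin (n + 1 + 1)}
    (h : IsGaleDual C w l) (ha : IsConfiguration a) {r : Fin (n + 1 + 1) → ℤ}
    (hr : IsAffineRelation a r) {m : ℕ} (hP : ¬ Polynomial.X ^ (m + 1) ∣ relPoly w r) :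
    Module.rank ℂ (LocalAlgebra a C 1) ≤ m := by
  refine rank_quotient_le (exists_sub_algebraMap_mem_maximalIdeal 1) _
    (algebraMap (Laurent n) _ (galeParam a l)) ?_ ?_ (relPoly w r) (h.aeval_relPoly_mem hr) hP
  · apply algebraMap_mem_maximalIdeal
    rw [galeParam, map_sub, evalAt_one_single, map_one, sub_self]
  · rw [← Localization.AtPrime.map_eq_maximalIdeal]
    exact h.map_pointIdeal_le ha fun f hf => IsLocalization.map_units _
      (⟨f, hf⟩ : (pointIdeal (1 : Fin n → ℂˣ)).primeCompl)

/-- Order `n + 2` would kill the moments `1, …, n + 1`; moment `0` vanishes because the relation is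
affine. These are `n + 2` moments on `n + 2` points. -/
theorem IsGaleDual.not_X_pow_dvd_relPoly {n : ℕ} {a : Fin (n + 1 + 1) → Fin n → ℤ}
    {C : Matrix (Fin n) (Fin (n + 1 + 1)) ℂ} {w : Fin (n + 1 + 1) → ℂ} {l : Fin (n + 1 + 1)}
    (h : IsGaleDual C w l) (ha : IsConfiguration a) (hiso : IsIsolatedSolution a C 1) :
    ¬ Polynomial.X ^ (n + 1 + 1) ∣ relPoly w (minorRel a) := by
  intro hdvd
  refine h.not_isIsolatedSolution ha (fun k hk => ?_) hiso
  cases k with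
  | zero => simpa using congrArg (Int.cast (R := ℂ)) (sum_minorRel a)
  | succ k => exact sum_mul_pow_eq_zero_of_dvd w _ hdvd (by omega)

theorem multiplicity_one_le {n : ℕ} {a : Fin (n + 1 + 1) → Fin n → ℤ}
    {C : Matrix (Fin n) (Fin (n + 1 + 1)) ℂ} (ha : IsConfiguration a) (hr : C.rank = n)
    (hiso : IsIsolatedSolution a C 1) : multiplicity a C 1 ≤ (n : ℕ∞) + 1 := by
  have h1 : (1 : Fin n → ℂˣ) ∈ solutions a C := by
    obtain ⟨U, -, hU⟩ := hiso
    exact (hU.symm ▸ Set.mem_singleton (1 : Fin n → ℂˣ) : (1 : Fin n → ℂˣ) ∈ U ∩ solutions a C).2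
  have h0 : ∀ i, ∑ j, C i j = 0 := fun i => by
    have := h1 i
    rw [evalAt_poly] at this
    simpa using this
  obtain ⟨w, l, h⟩ := exists_isGaleDual hr h0
  have := h.rank_localAlgebra_le ha (isAffineRelation_minorRel a) (h.not_X_pow_dvd_relPoly ha hiso)
  have h2 := Cardinal.toENat.monotone' this
  rw [multiplicity]
  simpa using h2

/-! ### The cyclic system -/

/-- Up to sign this is the `d`-th finite difference at `0` of a power of degree below `d`; the terms
with `j > d` are zero. -/
theorem sum_alternating_choose_mul_pow {N d k : ℕ} (hk : k < d) (hd : d < N) :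
    ∑ j : Fin N, (-1 : ℤ) ^ (j : ℕ) * (d.choose j : ℤ) * (j : ℤ) ^ k = 0 := by
  have h := congrFun (fwdDiff_iter_pow_eq_zero_of_lt (R := ℤ) hk) 0
  rw [fwdDiff_iter_eq_sum_shift] at h
  rw [Fin.sum_univ_eq_sum_range
      (fun j => (-1 : ℤ) ^ j * (d.choose j : ℤ) * (j : ℤ) ^ k) N,
    ← Finset.sum_subset (Finset.range_subset_range.2 (Nat.succ_le_of_lt hd))]
  · calc ∑ j ∈ Finset.range (d + 1), (-1 : ℤ) ^ j * (d.choose j : ℤ) * (j : ℤ) ^ k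
        = (-1) ^ d * ∑ j ∈ Finset.range (d + 1),
            ((-1 : ℤ) ^ (d - j) * d.choose j) • ((0 : ℤ) + j • 1) ^ k := by
          rw [Finset.mul_sum]
          refine Finset.sum_congr rfl fun j hj => ?_
          have hjd : j ≤ d := by simpa [Nat.lt_succ_iff] using hj
          have h2 : (-1 : ℤ) ^ j = (-1) ^ d * (-1) ^ (d - j) := by
            obtain ⟨e, rfl⟩ := Nat.exists_eq_add_of_le hjd
            rw [Nat.add_sub_cancel_left, pow_add, mul_assoc, ← mul_pow]; simp
          rw [h2]
          simp only [smul_eq_mul, nsmul_eq_mul, zero_add, mul_one]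
          ring
      _ = 0 := by rw [h]; simp
  · intro j _ hj
    rw [Nat.choose_eq_zero_of_lt (by simpa using hj)]
    simp

/-- A functional that kills all differences is a polynomial of degree at most `n` without constant
term, vanishing at `1, …, n`. Dividing by `j` leaves an invertible Vandermonde system. -/
theorem cyclic_isConfiguration {n : ℕ} (hn : 1 ≤ n) : IsConfiguration (cyclicExponents n 1) := by
  refine ⟨fun i j hij => ?_, ?_⟩
  · have := congrFun hij ⟨0, hn⟩
    simpa [cyclicExponents, Fin.ext_iff] using this
  · rw [affineSpan_convexHull]
    have hne : ((affineSpan ℝ (Set.range fun j => fun i => (cyclicExponents n 1 j i : ℝ)) :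
        AffineSubspace ℝ (Fin n → ℝ)) : Set (Fin n → ℝ)).Nonempty :=
      (Set.range_nonempty _).affineSpan ℝ
    rw [← AffineSubspace.direction_eq_top_iff_of_nonempty hne, direction_affineSpan]
    by_contra hlt
    obtain ⟨f, hf, hle⟩ := Submodule.exists_le_ker_of_lt_top _ (lt_top_iff_ne_top.2 hlt)
    apply hf
    have hj : ∀ j : Fin (n + 1 + 1), ∑ i : Fin n, (j : ℝ) ^ ((i : ℕ) + 1) * f (Pi.single i 1) = 0 := by
      intro j
      have h1 := hle (vsub_mem_vectorSpan ℝ (Set.mem_range_self j) (Set.mem_range_self 0))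
      rw [LinearMap.mem_ker, LinearMap.pi_apply_eq_sum_univ f] at h1
      rw [← h1]
      refine Finset.sum_congr rfl fun i _ => ?_
      have hs : (Pi.single i 1 : Fin n → ℝ) = fun j => if i = j then 1 else 0 := by
        ext j; simp [Pi.single_apply, eq_comm]
      rw [hs]
      simp [cyclicExponents]
    have h0 := Matrix.eq_zero_of_forall_index_sum_pow_mul_eq_zero
      (f := fun j : Fin n => ((j : ℕ) : ℝ) + 1) (v := fun i => f (Pi.single i 1)) ?_ ?_
    · refine LinearMap.pi_ext' fun i => LinearMap.ext_ring ?_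
      simpa using congrFun h0 i
    · intro i j hij
      simpa [Fin.ext_iff] using hij
    · intro j
      have := hj j.succ.castSucc
      simp only [pow_succ', mul_assoc, ← Finset.mul_sum] at this
      have hne : (((j.succ.castSucc : Fin (n + 1 + 1)) : ℕ) : ℝ) ≠ 0 := by
        simp; positivity
      simpa using (mul_eq_zero.1 this).resolve_left hne

/-- Row `i` has degree `d = i + 2`, so the columns `2, …, n + 1` form a triangular matrix with
diagonal entries `±1`. -/
theorem cyclic_rank (n : ℕ) : (cyclicCoeffs n 1).rank = n := by
  have hdet : ((cyclicCoeffs n 1).submatrix id (fun i : Fin n => i.succ.succ)).det ≠ 0 := by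
    rw [Matrix.det_of_isLowerTriangular]
    · rw [Finset.prod_ne_zero_iff]
      intro i _
      simp [cyclicCoeffs, add_comm, add_left_comm]
    · intro i j hij
      have hlt : (i : ℕ) < j := hij
      simp only [Matrix.submatrix_apply, id, cyclicCoeffs, Fin.val_succ]
      rw [Nat.choose_eq_zero_of_lt (by omega)]
      simp
  have hli := Matrix.linearIndependent_rows_of_det_ne_zero hdet
  have : LinearIndependent ℂ (cyclicCoeffs n 1).row :=
    LinearIndependent.of_comp (LinearMap.funLeft ℂ ℂ (fun i : Fin n => i.succ.succ)) hli
  simpa using this.rank_matrix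

theorem cyclic_sum_mul_pow {n k : ℕ} (hk : k ≤ 1) (i : Fin n) :
    ∑ j, cyclicCoeffs n 1 i j * (j : ℂ) ^ k = 0 := by
  have := sum_alternating_choose_mul_pow (N := n + 1 + 1) (d := 1 + (i + 1)) (k := k)
    (by omega) (by omega)
  simpa [cyclicCoeffs] using congrArg (Int.cast (R := ℂ)) this

/-- Differences of order at least `2` kill constant and linear sequences. -/
theorem cyclic_isGaleDual (n : ℕ) :
    IsGaleDual (cyclicCoeffs n 1) (fun j : Fin (n + 1 + 1) => ((j : ℕ) : ℂ)) 1 where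
  sum_eq i := by simpa using cyclic_sum_mul_pow (k := 0) (by omega) i
  sum_mul i := by simpa using cyclic_sum_mul_pow (k := 1) le_rfl i
  zero := by simp
  one := by simp
  rank := cyclic_rank n

/-- The affine relation between the exponents of the cyclic system. -/
def cyclicRel (n : ℕ) (j : Fin (n + 1 + 1)) : ℤ := (-1) ^ (j : ℕ) * ((n + 1).choose j : ℤ)

theorem cyclicRel_isAffineRelation (n : ℕ) : IsAffineRelation (cyclicExponents n 1) (cyclicRel n) where
  sum_eq := by
    simpa [cyclicRel] using
      sum_alternating_choose_mul_pow (N := n + 1 + 1) (d := n + 1) (k := 0) (by omega) (by omega)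
  sum_smul := by
    funext i
    simpa [cyclicRel, cyclicExponents] using
      sum_alternating_choose_mul_pow (N := n + 1 + 1) (d := n + 1) (k := i + 1) (by omega) (by omega)

/-- Were it zero, all moments of `cyclicRel n` at the distinct nodes `j` would vanish, and by
Vandermonde so would the relation, whose entry at `0` is `1`. -/
theorem cyclic_relPoly_ne_zero (n : ℕ) :
    relPoly (fun j : Fin (n + 1 + 1) => ((j : ℕ) : ℂ)) (cyclicRel n) ≠ 0 := by
  intro h0
  have h1 := Matrix.eq_zero_of_forall_pow_sum_mul_pow_eq_zero
    (f := fun j : Fin (n + 1 + 1) => ((j : ℕ) : ℂ)) (v := fun j => (cyclicRel n j : ℂ))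
    (fun i j hij => by simpa [Fin.ext_iff] using hij) ?_
  · simpa [cyclicRel] using congrFun h1 0
  · intro k
    rcases hk : (k : ℕ) with _ | k'
    · simpa using congrArg (Int.cast (R := ℂ)) (cyclicRel_isAffineRelation n).sum_eq
    · exact sum_mul_pow_eq_zero_of_dvd (m := n + 1) _ _ (h0 ▸ dvd_zero _) (by omega)

theorem cyclic_isIsolatedSolution {n : ℕ} (hn : 1 ≤ n) :
    IsIsolatedSolution (cyclicExponents n 1) (cyclicCoeffs n 1) 1 :=
  (cyclic_isGaleDual n).isIsolatedSolution_one (cyclic_isConfiguration hn)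
    (cyclicRel_isAffineRelation n) (cyclic_relPoly_ne_zero n)

/-! ### Lower bound by a formal curve -/

open PowerSeries in
/-- The formal exponential of the primitive of `(-1) ^ k X ^ k`. -/
theorem exists_formal_exp (k : ℕ) : ∃ f : (PowerSeries ℂ)ˣ, constantCoeff (f : PowerSeries ℂ) = 1 ∧
    d⁄dX ℂ (f : PowerSeries ℂ) = (f : PowerSeries ℂ) * (C ((-1 : ℂ) ^ k) * X ^ k) := by
  let g : PowerSeries ℂ := C ((-1) ^ k / ((k : ℂ) + 1)) * X ^ (k + 1)
  have hg : HasSubst g := HasSubst.of_constantCoeff_zero' (by simp [g])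
  have hc : constantCoeff ((exp ℂ).subst g : PowerSeries ℂ) = 1 := by
    obtain ⟨q, hq⟩ := X_dvd_iff.2 (show constantCoeff (exp ℂ - 1) = 0 by simp)
    have h1 : (exp ℂ).subst g = 1 + g * q.subst g := by
      rw [← coe_substAlgHom hg, eq_add_of_sub_eq' hq, map_add, map_mul, map_one, coe_substAlgHom,
        subst_X hg]
    rw [h1]
    simp [g]
  obtain ⟨u, hu⟩ := isUnit_iff_constantCoeff.2 (hc ▸ isUnit_one)
  refine ⟨u, hu ▸ hc, ?_⟩
  rw [hu, derivative_subst hg, derivative_exp]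
  congr 1
  have hk : ((k : ℂ) + 1) ≠ 0 := by exact_mod_cast Nat.succ_ne_zero k
  rw [Derivation.leibniz, derivative_C, derivative_pow, derivative_X, smul_zero, add_zero,
    smul_eq_mul, mul_one, Nat.add_sub_cancel, ← mul_assoc, ← map_natCast (C (R := ℂ)), ← map_mul]
  congr 2
  push_cast
  field_simp

/-- The monomial character with values in formal power series. -/
def formalChar {n : ℕ} (f : Fin n → (PowerSeries ℂ)ˣ) :
    Multiplicative (Fin n → ℤ) →* PowerSeries ℂ where
  toFun α := ((∏ i, f i ^ (Multiplicative.toAdd α i) : (PowerSeries ℂ)ˣ) : PowerSeries ℂ)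
  map_one' := by simp
  map_mul' α β := by
    rw [← Units.val_mul, ← Finset.prod_mul_distrib]
    simp only [toAdd_mul, Pi.add_apply, zpow_add]

/-- The substitution of formal units into a Laurent polynomial. -/
def formalSubst {n : ℕ} (f : Fin n → (PowerSeries ℂ)ˣ) : Laurent n →ₐ[ℂ] PowerSeries ℂ :=
  AddMonoidAlgebra.lift ℂ (PowerSeries ℂ) (Fin n → ℤ) (formalChar f)

theorem formalSubst_single {n : ℕ} (f : Fin n → (PowerSeries ℂ)ˣ) (α : Fin n → ℤ) (c : ℂ) :
    formalSubst f (AddMonoidAlgebra.single α c) =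
      c • ((∏ i, f i ^ α i : (PowerSeries ℂ)ˣ) : PowerSeries ℂ) := by
  rw [formalSubst, AddMonoidAlgebra.lift_single]
  rfl

theorem constantCoeff_formalSubst {n : ℕ} {f : Fin n → (PowerSeries ℂ)ˣ}
    (hf : ∀ i, PowerSeries.constantCoeff (f i : PowerSeries ℂ) = 1) (p : Laurent n) :
    PowerSeries.constantCoeff (formalSubst f p) = evalAt 1 p := by
  have hu : ∀ i, Units.map (PowerSeries.constantCoeff (R := ℂ) : PowerSeries ℂ →* ℂ) (f i) = 1 :=
    fun i => Units.ext (hf i)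
  induction p using AddMonoidAlgebra.induction_linear with
  | zero => simp
  | add p q hp hq => rw [map_add, map_add, map_add, hp, hq]
  | single α c =>
    have h1 : PowerSeries.constantCoeff ((∏ i, f i ^ α i : (PowerSeries ℂ)ˣ) : PowerSeries ℂ) = 1 := by
      have : Units.map (PowerSeries.constantCoeff (R := ℂ) : PowerSeries ℂ →* ℂ)
          (∏ i, f i ^ α i) = 1 := by simp [map_prod, map_zpow, hu]
      exact congrArg Units.val this
    have h2 : (AddMonoidAlgebra.single α c : Laurent n) = c • AddMonoidAlgebra.single α 1 := by
      rw [AddMonoidAlgebra.smul_single, smul_eq_mul, mul_one]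
    rw [formalSubst_single, PowerSeries.smul_eq_C_mul, map_mul, h1, h2, map_smul, evalAt_one_single]
    simp

open PowerSeries in
-- With `f i = exp ((-1) ^ i X ^ (i + 1) / (i + 1))`, the monomial of exponent `j` is the
-- exponential of `log (1 + j X)` truncated after degree `n`. The logarithmic derivatives thus agree
-- modulo `X ^ n`.
theorem exists_cyclic_formal_solution (n : ℕ) : ∃ f : Fin n → (PowerSeries ℂ)ˣ,
    (∀ i, constantCoeff (f i : PowerSeries ℂ) = 1) ∧
    ∀ j : Fin (n + 1 + 1), X ^ (n + 1) ∣
      ((∏ i, f i ^ cyclicExponents n 1 j i : (PowerSeries ℂ)ˣ) : PowerSeries ℂ) -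
        (1 + C ((j : ℕ) : ℂ) * X) := by
  choose f hf hd using exists_formal_exp
  refine ⟨fun i => f i, fun i => hf i, fun j => ?_⟩
  have hprod : ((∏ i : Fin n, f i ^ cyclicExponents n 1 j i : (PowerSeries ℂ)ˣ) : PowerSeries ℂ) =
      ∏ i : Fin n, (f i : PowerSeries ℂ) ^ ((j : ℕ) ^ ((i : ℕ) + 1)) := by
    rw [Units.coe_prod]
    refine Finset.prod_congr rfl fun i _ => ?_
    have : cyclicExponents n 1 j i = (((j : ℕ) ^ ((i : ℕ) + 1) : ℕ) : ℤ) := by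
      simp [cyclicExponents]
    rw [this, zpow_natCast, Units.val_pow_eq_pow_val]
  rw [hprod]
  refine X_pow_succ_dvd_sub_of_logDeriv
    (derivative_prod_pow Finset.univ (fun i : Fin n => (f i : PowerSeries ℂ)) _ (fun i => hd i) _)
    (derivative_linear _) ?_ ?_
  · simp [map_prod, hf]
  · rw [X_pow_dvd_iff]
    intro k hk
    rw [map_sub, map_sum, logDerivLinear, coeff_mk, Finset.sum_eq_single ⟨k, hk⟩]
    · rw [← map_natCast (C (R := ℂ)), coeff_C_mul, coeff_C_mul, coeff_X_pow, if_pos rfl, neg_pow]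
      push_cast
      ring
    · intro i _ hik
      rw [← map_natCast (C (R := ℂ)), coeff_C_mul, coeff_C_mul, coeff_X_pow, if_neg, mul_zero,
        mul_zero]
      rintro rfl
      exact hik rfl
    · simp

open PowerSeries in
-- The formal curve induces `Λ` from the local algebra to `ℂ⟦X⟧ / (X ^ (n + 1))`. The Gale parameter
-- maps to `X`, so its first `n + 1` powers are independent.
theorem cyclic_le_rank (n : ℕ) : ((n + 1 : ℕ) : Cardinal) ≤
    Module.rank ℂ (LocalAlgebra (cyclicExponents n 1) (cyclicCoeffs n 1) 1) := by
  obtain ⟨f, hf, hfj⟩ := exists_cyclic_formal_solution n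
  let T : Ideal (PowerSeries ℂ) := Ideal.span {X ^ (n + 1)}
  let Ψ : Localization.AtPrime (pointIdeal (1 : Fin n → ℂˣ)) →ₐ[ℂ] PowerSeries ℂ :=
    IsLocalization.liftAlgHom (M := (pointIdeal (1 : Fin n → ℂˣ)).primeCompl) (f := formalSubst f)
      (fun y => by
        rw [isUnit_iff_constantCoeff, constantCoeff_formalSubst hf]
        exact IsUnit.mk0 _ y.2)
  have hΨ : ∀ p, Ψ (algebraMap (Laurent n) _ p) = formalSubst f p := fun p =>
    IsLocalization.lift_eq _ p
  let Λ : LocalAlgebra (cyclicExponents n 1) (cyclicCoeffs n 1) 1 →ₐ[ℂ] PowerSeries ℂ ⧸ T :=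
    Ideal.Quotient.liftₐ _ ((Ideal.Quotient.mkₐ ℂ T).comp Ψ) (by
      intro x hx
      suffices h : (systemIdeal (cyclicExponents n 1) (cyclicCoeffs n 1)).map
          (algebraMap (Laurent n) (Localization.AtPrime (pointIdeal (1 : Fin n → ℂˣ)))) ≤
          RingHom.ker ((Ideal.Quotient.mkₐ ℂ T).comp Ψ) from h hx
      rw [Ideal.map_le_iff_le_comap, systemIdeal, Ideal.span_le]
      rintro _ ⟨i, rfl⟩
      change Ideal.Quotient.mk T (Ψ (algebraMap (Laurent n) _ _)) = 0
      rw [hΨ, Ideal.Quotient.eq_zero_iff_mem, Ideal.mem_span_singleton, poly, map_sum]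
      -- The coefficients annihilate the binomials `1 + j X` exactly, so they annihilate the
      -- monomials of the curve modulo `X ^ (n + 1)`.
      have h0 : ∑ j, cyclicCoeffs n 1 i j • (1 + C ((j : ℕ) : ℂ) * X : PowerSeries ℂ) = 0 := by
        simp only [smul_add, ← smul_mul_assoc, Finset.sum_add_distrib,
          ← Finset.sum_mul, (cyclic_isGaleDual n).sum_eq, PowerSeries.smul_eq_C_mul, ← map_mul,
          ← map_sum, (cyclic_isGaleDual n).sum_mul]
        simp
      rw [← sub_zero (∑ j, _), ← h0, ← Finset.sum_sub_distrib]
      refine Finset.dvd_sum fun j _ => ?_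
      rw [formalSubst_single, ← smul_sub, PowerSeries.smul_eq_C_mul]
      exact (hfj j).mul_left _)
  -- This is the Gale parameter for `l = 1`, since the exponent at index `0` is the zero vector.
  let t : LocalAlgebra (cyclicExponents n 1) (cyclicCoeffs n 1) 1 :=
    Ideal.Quotient.mk _ (algebraMap (Laurent n) _
      (AddMonoidAlgebra.single (cyclicExponents n 1 1) 1 - 1))
  have ht : Λ t = Ideal.Quotient.mk T X := by
    change Ideal.Quotient.mk T (Ψ (algebraMap (Laurent n) _ _)) = _
    rw [hΨ, Ideal.Quotient.mk_eq_mk_iff_sub_mem, Ideal.mem_span_singleton, map_sub, map_one,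
      formalSubst_single]
    have := hfj 1
    simpa [sub_sub] using this
  have hli : LinearIndependent ℂ (fun k : Fin (n + 1) => t ^ (k : ℕ)) := by
    refine LinearIndependent.of_comp Λ.toLinearMap ?_
    rw [Fintype.linearIndependent_iff]
    intro c hc k
    have h1 : Ideal.Quotient.mk T (∑ k : Fin (n + 1), C (c k) * X ^ (k : ℕ)) = 0 := by
      rw [← hc, map_sum]
      refine Finset.sum_congr rfl fun k _ => ?_
      rw [Function.comp_apply, AlgHom.toLinearMap_apply, map_pow, ht, ← PowerSeries.smul_eq_C_mul,
        ← map_pow]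
      rfl
    rw [Ideal.Quotient.eq_zero_iff_mem, Ideal.mem_span_singleton, X_pow_dvd_iff] at h1
    have h2 := h1 k k.2
    rw [map_sum, Finset.sum_eq_single k] at h2
    · simpa using h2
    · intro i _ hik
      rw [coeff_C_mul, coeff_X_pow, if_neg, mul_zero]
      exact fun h => hik (Fin.ext h.symm)
    · simp
  simpa using hli.cardinal_le_rank

theorem cyclic_multiplicity {n : ℕ} (hn : 1 ≤ n) :
    multiplicity (cyclicExponents n 1) (cyclicCoeffs n 1) 1 = (n : ℕ∞) + 1 := by
  refine le_antisymm (multiplicity_one_le (cyclic_isConfiguration hn) (cyclic_rank n)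
    (cyclic_isIsolatedSolution hn)) ?_
  simpa [multiplicity] using Cardinal.toENat.monotone' (cyclic_le_rank n)

end SparseSystem

end

theorem mainTheorem9 (n : ℕ) (hn : 1 ≤ n) :
    IsGreatest
      {μ : ℕ∞ | ∃ (a : Fin (n + 1 + 1) → Fin n → ℤ) (C : Matrix (Fin n) (Fin (n + 1 + 1)) ℂ),
        SparseSystem.IsConfiguration a ∧ C.rank = n ∧
        SparseSystem.IsIsolatedSolution a C 1 ∧
        SparseSystem.multiplicity a C 1 = μ}
      ((n : ℕ∞) + 1) ∧
    SparseSystem.IsConfiguration (SparseSystem.cyclicExponents n 1) ∧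
    (SparseSystem.cyclicCoeffs n 1).rank = n ∧
    SparseSystem.IsIsolatedSolution
      (SparseSystem.cyclicExponents n 1) (SparseSystem.cyclicCoeffs n 1) 1 ∧
    SparseSystem.multiplicity
      (SparseSystem.cyclicExponents n 1) (SparseSystem.cyclicCoeffs n 1) 1 = (n : ℕ∞) + 1 := by
  have h1 := SparseSystem.cyclic_isConfiguration hn
  have h2 := SparseSystem.cyclic_rank n
  have h3 := SparseSystem.cyclic_isIsolatedSolution hn
  have h4 := SparseSystem.cyclic_multiplicity hn
  refine ⟨⟨⟨_, _, h1, h2, h3, h4⟩, ?_⟩, h1, h2, h3, h4⟩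
  rintro _ ⟨a, C, ha, hr, hiso, rfl⟩
  exact SparseSystem.multiplicity_one_le ha hr hiso
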